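/- Let $n\ge 2$, $k=n-1$, and let $R(T)=\mathbb{Z}[e^{\pm a_1},\dots,e^{\pm a_n}]/(e^{a_1+\cdots+a_n}-1)$; indices of the $a_i$ are read modulo $n$ (so $a_0=a_n$). Let $R(T)^\Delta$ be the localization of $R(T)$ by the elements $1-e^{a_i-a_j}$ $(i\not\equiv j)$. Put $b_i=1-e^{-a_i}$ and $\Omega(b_i|y)=\prod_{j\ge1}(1-b_iy_j)^{-1}$, a formal power series in $y=(y_1,y_2,\dots)$. For $i\in\mathbb{Z}/n\mathbb{Z}$ let $\alpha_i=a_i-a_{i+1}$ and let $s_i$ act on power series in $y$ over $R(T)^\Delta$ by exchanging $a_i$ and $a_{i+1}$ in the coefficients, followed for $i=0$ by multiplication by $\Omega(b_1|y)/\Omega(b_n|y)$; put $T_i=(1-e^{\alpha_i})^{-1}(s_i-1)$. For a $k$-bounded partition $\lambda$ (i.e. $\lambda_1\le k$) the (non-closed) $K$-theoretic double $k$-Schur function is $$g^{(k)}_\lambda(y|b)=T_{x_\lambda}(1),\qquad x_\lambda=\cdots(s_{\lambda_2-2}\cdots s_0s_{-1})(s_{\lambda_1-1}\cdots s_1s_0),$$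 where $T_{x_\lambda}$ is the composition of the $T_i$ along this (reduced) word, which reads the residues $\mathrm{res}(i,j)=j-i \bmod n$ of the boxes of $\lambda$ from the bottom row to the top row and from right to left in each row. Define power series $z_{ij}$ for $i,j\in\mathbb{Z}$, $j-i<n$, by $z_{ij}=0$ for $i>j$, $z_{ii}=\Omega(b_i|y)$ and $(b_i-b_j)z_{ij}=z_{i,j-1}-z_{i+1,j}$ for $i<j$ (indices of $b$ modulo $n$), and let $(ZA)_{ij}=e^{-a_j}z_{ij}-z_{i,j-1}$; this is the product of $Z=(z_{ij})$ with the bidiagonal matrix $A$, $A_{jj}=e^{-a_j}$, $A_{j,j+1}=-1$. Let $\lambda$ be $k$-small, i.e. $k$-bounded with $\lambda_1+\ell(\lambda)\le n$, let $\lambda'$ be its conjugate, and put $r=\lambda_1$, $l=n-\lambda'_1+1$. For $1\le p\le r$ and $m\ge0$ let $f_m^{\langle m,p\rangle;\lambda}=h_m\big(e^{-a_{\mathrm{res}(s,p)}} \mid m\le s\le\lambda'_p\big)$ with $h_m$ the complete homogeneous symmetric polynomial ($h_0=1$, and $h_m$ of no variables is $0$ for $m>0$). Let $W_\lambda$ be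 the $r\times(\lambda'_1+r)$ matrix with columns numbered $l,\dots,n+r$ whose $p$-th row has the entry $(-1)^m f_m^{\langle m,p\rangle;\lambda}$ in column $n+p-m$ for $m\ge0$, and $0$ in the columns to the right of $n+p$. Let $$N_\lambda=\begin{pmatrix}(ZA)_{[l,n]}^{[l,n+r]}\\ W_\lambda\end{pmatrix},\qquad \xi_\lambda(y)=\prod_{i=1}^{\lambda'_1}\Omega(b_{\mathrm{res}(i,1)}|y),$$ where $(ZA)_{[l,n]}^{[l,n+r]}$ is the block with rows $l,\dots,n$ and columns $l,\dots,n+r$. For a box $x=(i,i)$ on the main diagonal $\mathrm{diag}(\lambda)$ let $r(x)$ be the residue of the rightmost box in the row of $x$ and $b(x)$ the residue of the bottom box in the column of $x$. Then $$g^{(k)}_\lambda(y|b)=e^{\sum_{x\in\mathrm{diag}(\lambda)}(a_{r(x)+1}-a_{b(x)})}\;e^{\sum_{i=1}^{\lambda'_1}a_{\mathrm{res}(i,1)}}\;\frac{\det(N_\lambda)}{\xi_\lambda(y)} .$$ -/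

import Mathlib

noncomputable section

namespace KSchur

/-! Residues modulo `n` are elements of `ZMod n`; in the list `a_1, ..., a_n`
the index `n` is the residue `0`. -/

/-- The weight lattice of the maximal torus `T` of `SL_n`: the lattice `ℤ a_1 ⊕ ... ⊕ ℤ a_n`
modulo `ℤ (a_1 + ... + a_n)`. -/
abbrev Weight (n : ℕ) : Type :=
  (ZMod n → ℤ) ⧸ AddSubgroup.zmultiples (1 : ZMod n → ℤ)

/-- The weight `a_i`. -/
def a {n : ℕ} (i : ZMod n) : Weight n :=
  QuotientAddGroup.mk (Pi.single i 1)

/-- The representation ring `R(T) = ℤ[e^{± a_1}, ..., e^{± a_n}] / (e^{a_1 + ... + a_n} - 1)`,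
i.e. the group ring of the weight lattice. -/
abbrev RT (n : ℕ) : Type := AddMonoidAlgebra ℤ (Weight n)

/-- `e^μ` in `R(T)`. -/
def expRT {n : ℕ} (μ : Weight n) : RT n := AddMonoidAlgebra.single μ 1

/-- The multiplicative set generated by the `1 - e^{a_i - a_j}`, `i ≠ j`. -/
def rootMonoid (n : ℕ) : Submonoid (RT n) :=
  Submonoid.closure {x | ∃ i j : ZMod n, i ≠ j ∧ x = 1 - expRT (a i - a j)}

/-- The localization `R(T)^Δ` of `R(T)` by the multiplicative set generated by the
`1 - e^{a_i - a_j}`, `i ≠ j`. -/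
def RTΔ (n : ℕ) : Type := Localization (rootMonoid n)

instance (n : ℕ) : CommRing (RTΔ n) := inferInstanceAs (CommRing (Localization (rootMonoid n)))

instance (n : ℕ) : Algebra (RT n) (RTΔ n) :=
  inferInstanceAs (Algebra (RT n) (Localization (rootMonoid n)))

instance (n : ℕ) : IsLocalization (rootMonoid n) (RTΔ n) :=
  inferInstanceAs (IsLocalization (rootMonoid n) (Localization (rootMonoid n)))

/-- `e^μ` in `R(T)^Δ`. -/
def ex {n : ℕ} (μ : Weight n) : RTΔ n := algebraMap (RT n) (RTΔ n) (expRT μ)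

/-- The action of a permutation `s` of the indices on weights, `a_i ↦ a_{s i}`. -/
def permWeight {n : ℕ} (s : Equiv.Perm (ZMod n)) : Weight n →+ Weight n :=
  QuotientAddGroup.map _ _
    ((LinearMap.funLeft ℤ ℤ (s.symm : ZMod n → ZMod n)).toAddMonoidHom)
    (by
      rw [AddSubgroup.zmultiples_le]
      exact AddSubgroup.mem_zmultiples (1 : ZMod n → ℤ))

theorem permWeight_a {n : ℕ} (s : Equiv.Perm (ZMod n)) (i : ZMod n) :
    permWeight s (a i) = a (s i) := by
  unfold permWeight a
  rw [QuotientAddGroup.map_mk]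
  congr 1
  funext j
  simp only [LinearMap.toAddMonoidHom_coe, LinearMap.funLeft_apply, Pi.single_apply,
    Equiv.symm_apply_eq]

/-- The action of a permutation of the indices on `R(T)`. -/
def permRT {n : ℕ} (s : Equiv.Perm (ZMod n)) : RT n →+* RT n :=
  AddMonoidAlgebra.mapDomainRingHom ℤ (permWeight s)

theorem permRT_expRT {n : ℕ} (s : Equiv.Perm (ZMod n)) (μ : Weight n) :
    permRT s (expRT μ) = expRT (permWeight s μ) := by
  simp [permRT, expRT]

theorem rootMonoid_le_comap {n : ℕ} (s : Equiv.Perm (ZMod n)) :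
    rootMonoid n ≤ (rootMonoid n).comap (permRT s) := by
  refine Submonoid.closure_le.2 ?_
  rintro x ⟨i, j, hij, rfl⟩
  refine Submonoid.subset_closure ⟨s i, s j, fun h => hij (s.injective h), ?_⟩
  simp [permRT_expRT, permWeight_a]

/-- The action of a permutation of the indices on `R(T)^Δ`. -/
def permRTΔ {n : ℕ} (s : Equiv.Perm (ZMod n)) : RTΔ n →+* RTΔ n :=
  IsLocalization.map (RTΔ n) (permRT s) (rootMonoid_le_comap s)

theorem permRTΔ_ex {n : ℕ} (s : Equiv.Perm (ZMod n)) (μ : Weight n) :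
    permRTΔ s (ex μ) = ex (permWeight s μ) := by
  unfold permRTΔ ex
  rw [IsLocalization.map_eq, permRT_expRT]

/-- Formal power series in infinitely many variables `y_1, y_2, ...` (indexed by `ℕ`) with
coefficients in `R(T)^Δ`. It contains the ring of symmetric formal power series with
coefficients in `R(T)`. -/
abbrev Series (n : ℕ) : Type := MvPowerSeries ℕ (RTΔ n)

/-- Constants in the ring of power series. -/
abbrev cst {n : ℕ} (c : RTΔ n) : Series n := MvPowerSeries.C c

/-- `b_i = 1 - e^{-a_i}`. -/
def b {n : ℕ} (i : ZMod n) : RTΔ n := 1 - ex (-a i)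

/-- `∏_j (1 - c y_j)⁻¹ = ∏_j ∑_m c^m y_j^m`: the coefficient of every monomial of total
degree `d` is `c^d`. -/
def cauchy {n : ℕ} (c : RTΔ n) : Series n := fun m => c ^ m.degree

theorem constantCoeff_cauchy {n : ℕ} (c : RTΔ n) :
    MvPowerSeries.constantCoeff (cauchy c) = ((1 : (RTΔ n)ˣ) : RTΔ n) := by
  rw [← MvPowerSeries.coeff_zero_eq_constantCoeff_apply]
  change c ^ (Finsupp.degree (0 : ℕ →₀ ℕ)) = _
  simp

/-- `Ω(b_i | y) = ∏_j (1 - b_i y_j)⁻¹`, as an invertible power series. -/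
def Ω {n : ℕ} (i : ZMod n) : (Series n)ˣ where
  val := cauchy (b i)
  inv := MvPowerSeries.invOfUnit (cauchy (b i)) 1
  val_inv := MvPowerSeries.mul_invOfUnit _ _ (constantCoeff_cauchy _)
  inv_val := by
    rw [mul_comm]
    exact MvPowerSeries.mul_invOfUnit _ _ (constantCoeff_cauchy _)

/-- The action of the simple reflections on power series. The (level zero) action on coefficients
exchanges `a_i` and `a_{i+1}`; for `i = 0` this is `s_θ`, which exchanges `a_n` and `a_1`,
and `s_0(f) = Ω(b_1|y) / Ω(b_n|y) * s_θ(f)`. -/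
def simpleReflection {n : ℕ} (i : ZMod n) (f : Series n) : Series n :=
  (if i = 0 then ((Ω (1 : ZMod n) / Ω (0 : ZMod n) : (Series n)ˣ) : Series n) else 1) *
    MvPowerSeries.map (permRTΔ (Equiv.swap i (i + 1))) f

/-- The simple root `α_i = a_i - a_{i+1}`; in particular `α_0 = a_n - a_1 = -θ`. -/
def α {n : ℕ} (i : ZMod n) : Weight n := a i - a (i + 1)

/-- The elements `1 - e^{a_i - a_j}`, `i ≠ j`, are invertible in `R(T)^Δ`, so that `Ring.inverse`
is the true inverse of them. -/
theorem isUnit_one_sub_ex {n : ℕ} {i j : ZMod n} (h : i ≠ j) :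
    IsUnit (1 - ex (a i - a j) : RTΔ n) := by
  have := IsLocalization.map_units (RTΔ n)
    (⟨1 - expRT (a i - a j), Submonoid.subset_closure ⟨i, j, h, rfl⟩⟩ : rootMonoid n)
  simpa [ex] using this

theorem ex_add {n : ℕ} (μ ν : Weight n) : ex (μ + ν) = ex μ * ex ν := by
  simp [ex, expRT, ← map_mul, AddMonoidAlgebra.single_mul_single]

theorem ex_zero {n : ℕ} : ex (0 : Weight n) = 1 := by
  rw [ex, expRT, ← AddMonoidAlgebra.one_def, map_one]

theorem isUnit_b_sub_b {n : ℕ} {i j : ZMod n} (h : i ≠ j) : IsUnit (b i - b j : RTΔ n) := by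
  have h1 : (b i - b j : RTΔ n) = ex (-a j) * (1 - ex (a j - a i)) := by
    rw [mul_sub, ← ex_add]
    simp [b, sub_eq_add_neg]
    ring
  rw [h1]
  refine IsUnit.mul (IsUnit.of_mul_eq_one (ex (a j)) ?_) (isUnit_one_sub_ex h.symm)
  rw [← ex_add, neg_add_cancel, ex_zero]

/-- The Demazure operator `T_i = (1 - e^{α_i})⁻¹ (s_i - 1)`. -/
def T {n : ℕ} (i : ZMod n) (f : Series n) : Series n :=
  cst (Ring.inverse (1 - ex (α i))) * (simpleReflection i f - f)

/-- The operator `T_{i_1} ∘ ... ∘ T_{i_m}` attached to the word `s_{i_1} ... s_{i_m}`. -/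
def Tword {n : ℕ} (w : List (ZMod n)) (f : Series n) : Series n :=
  w.foldr T f

/-! Partitions are Young diagrams; Mathlib numbers rows and columns from `0`, so
`lam.rowLen i` is `λ_{i+1}` and `lam.colLen j` is `λ'_{j+1}`. -/

/-- A partition is `k`-small (`k = n - 1`) if it is `k`-bounded and `λ_1 + ℓ(λ) ≤ n`. -/
def IsKSmall (n : ℕ) (lam : YoungDiagram) : Prop :=
  lam.rowLen 0 < n ∧ lam.rowLen 0 + lam.colLen 0 ≤ n

/-- The standard reduced word of the affine Grassmannian element `x_λ` attached to a `k`-bounded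
partition: the residues (column minus row, mod `n`) of the boxes, read from the bottom row
to the top row and from right to left in each row:
`x_λ = ⋯ (s_{λ_2 - 2} ⋯ s_0 s_{-1}) (s_{λ_1 - 1} ⋯ s_1 s_0)`. -/
def readingWord (n : ℕ) (lam : YoungDiagram) : List (ZMod n) :=
  ((List.range (lam.colLen 0)).flatMap fun i =>
    (List.range (lam.rowLen i)).map fun j => (j : ZMod n) - (i : ZMod n)).reverse

/-- The (non-closed) `K`-theoretic double `k`-Schur function `g_λ^{(k)}(y|b) = T_{x_λ}(1)`,
where `k = n - 1`. -/
def g (n : ℕ) (lam : YoungDiagram) : Series n := Tword (readingWord n lam) 1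

/-- The functions `z_{i,i+d}`: `z_{ii} = Ω(b_i|y)` and
`(b_i - b_j) z_{ij} = z_{i,j-1} - z_{i+1,j}`, indices of `b` modulo `n`. -/
def zAux (n : ℕ) : ℕ → ℤ → Series n
  | 0, i => (Ω (i : ZMod n) : Series n)
  | d + 1, i =>
      cst (Ring.inverse (b (i : ZMod n) - b ((i + (d + 1 : ℕ) : ℤ) : ZMod n))) *
        (zAux n d i - zAux n d (i + 1))

/-- The entries `z_{ij}` of the upper-triangular matrix `Z`, extended periodically to `i, j ∈ ℤ`,
and regarded as power series in `y` (only used for `j - i < n`). -/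
def z (n : ℕ) (i j : ℤ) : Series n :=
  if i ≤ j then zAux n (j - i).toNat i else 0

/-- The entries of the bidiagonal matrix `A`, extended periodically: `A_{jj} = e^{-a_j}` and
`A_{j,j+1} = -1`. -/
def A (n : ℕ) (i j : ℤ) : RTΔ n :=
  if i = j then ex (-a (j : ZMod n)) else if i + 1 = j then -1 else 0

/-- The entries of the matrix product `Z A`; since `Z` and `A` are upper-triangular only the
indices `i ≤ m ≤ j` contribute. -/
def ZA (n : ℕ) (i j : ℤ) : Series n :=
  ∑ m ∈ Finset.Icc i j, z n i m * cst (A n m j)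

/-- The relations `[A, Z] = 0` defining the centralizer family. -/
theorem z_relation (n : ℕ) {i j : ℤ} (hij : i < j) (h : (i : ZMod n) ≠ (j : ZMod n)) :
    cst (b (i : ZMod n) - b (j : ZMod n)) * z n i j = z n i (j - 1) - z n (i + 1) j := by
  obtain ⟨d, rfl⟩ : ∃ d : ℕ, j = i + (d + 1 : ℕ) :=
    ⟨(j - i - 1).toNat, by omega⟩
  have e1 : (i + ((d + 1 : ℕ) : ℤ) - i).toNat = d + 1 := by omega
  have e2 : (i + ((d + 1 : ℕ) : ℤ) - 1 - i).toNat = d := by omega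
  have e3 : (i + ((d + 1 : ℕ) : ℤ) - (i + 1)).toNat = d := by omega
  have c2 : i ≤ i + ((d + 1 : ℕ) : ℤ) - 1 := by omega
  have c3 : i + 1 ≤ i + ((d + 1 : ℕ) : ℤ) := by omega
  rw [z, z, z, if_pos hij.le, if_pos c2, if_pos c3, e1, e2, e3, zAux, ← mul_assoc, ← map_mul,
    Ring.mul_inverse_cancel _ (isUnit_b_sub_b h), map_one, one_mul]

/-- For `0 ≤ m` and the column `p + 1` of `λ`, the complete symmetric polynomial
`f_m^{⟨m,p+1⟩;λ} = h_m (e^{-a_{res(s,p+1)}} | m ≤ s ≤ λ'_{p+1})`, where `s` numbers the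
rows from `1`. -/
def f (n : ℕ) (lam : YoungDiagram) (m p : ℕ) : RTΔ n :=
  MvPolynomial.aeval
    (fun s : Finset.Icc m (lam.colLen p) => ex (-a (((p : ℤ) + 1 - (s : ℕ) : ℤ) : ZMod n)))
    (MvPolynomial.hsymm (Finset.Icc m (lam.colLen p)) ℤ m)

/-- The lower block `W_λ`. Its row `p + 1` (for `0 ≤ p < λ_1`) has the entry
`(-1)^m f_m^{⟨m,p+1⟩;λ}` in the column numbered `n + p + 1 - m` for `m ≥ 0` (so the entry `1`
in the column `n + p + 1`) and `0` in the columns further to the right. The columns of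
the whole matrix are numbered by `l, ..., n + r`. -/
def W (n : ℕ) (lam : YoungDiagram) (p : ℕ) (c : ℤ) : RTΔ n :=
  if c ≤ n + p + 1 then
    (-1) ^ ((n : ℤ) + p + 1 - c).toNat * f n lam ((n : ℤ) + p + 1 - c).toNat p
  else 0

/-- `l = n - λ'_1 + 1`. -/
def l (n : ℕ) (lam : YoungDiagram) : ℤ := (n : ℤ) - lam.colLen 0 + 1

/-- The square matrix `N_λ` of size `λ'_1 + λ_1`. Its columns correspond to `l, ..., n + r` with
`r = λ_1`; its upper block is `(ZA)_{[l,n]}^{[l,n+r]}` and its lower block is `W_λ`. -/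
def N (n : ℕ) (lam : YoungDiagram) :
    Matrix (Fin (lam.colLen 0 + lam.rowLen 0)) (Fin (lam.colLen 0 + lam.rowLen 0)) (Series n) :=
  Matrix.of fun p q =>
    if (p : ℕ) < lam.colLen 0 then ZA n (l n lam + (p : ℕ)) (l n lam + (q : ℕ))
    else cst (W n lam ((p : ℕ) - lam.colLen 0) (l n lam + (q : ℕ)))

/-- `ξ_λ(y) = ∏_{i=1}^{λ'_1} Ω(b_{res(i,1)}|y)`. -/
def ξ (n : ℕ) (lam : YoungDiagram) : (Series n)ˣ :=
  ∏ i ∈ Finset.range (lam.colLen 0), Ω (-(i : ZMod n))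

/-- `∑_{x ∈ diag(λ)} (a_{r(x)+1} - a_{b(x)})`, where for the box `x` in row and column `i + 1`
the rightmost box of its row has residue `r(x) = λ_{i+1} - (i + 1)`, and the bottom
box of its column has residue `b(x) = (i + 1) - λ'_{i+1}`. -/
def diagWeight (n : ℕ) (lam : YoungDiagram) : Weight n :=
  ∑ i ∈ (Finset.range (lam.colLen 0)).filter (fun i => (i, i) ∈ lam),
    (a ((((lam.rowLen i : ℤ) - (i + 1)) + 1 : ℤ) : ZMod n) -
      a ((((i : ℤ) + 1) - lam.colLen i : ℤ) : ZMod n))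

/-- `∑_{i=1}^{λ'_1} a_{res(i,1)}`. -/
def columnWeight (n : ℕ) (lam : YoungDiagram) : Weight n :=
  ∑ i ∈ Finset.range (lam.colLen 0), a (-(i : ZMod n))

end KSchur

end

/-!
Write `L = λ'_1` and `m = λ'_1 + λ_1 ≤ n`, number the columns of `N_λ` by `t = 0, ..., m - 1`, and
attach to the column `t` the node `β_t = b_{t + 1 - L}`; differences of distinct nodes are
invertible. Multiply `N_λ` by the Newton matrix `(∏_{t < q} (β_k - β_t))_{q, k}`, which replaces
each row by the values at the nodes of the polynomial with these coefficients in the Newton basis.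
The recursion of `Z A` is the one of divided differences, so its row `p` becomes
`e^{-a_k} Ω(b_k|y) ∏_{t < p} (β_k - β_t)`. The row of `W_λ` belonging to a column of height `h`
becomes `(β_k - 1)^h ∏_{t < L + p - h} (β_k - β_t)`, since complete symmetric polynomials are the
coefficients of powers in the Newton basis. So `det N_λ` is a quotient of alternants.

An elementary reflection `s_i` exchanges two consecutive nodes, hence reverses the signs of both
alternants, up to changing the node of the unique row whose product ends between the two. By
linearity in that row, `T_i` raises its exponent `h` by one, that is, adds a box of residue `i` to
the shape. The theorem follows by adding the boxes of `λ` one at a time; any linear extension of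
the order on the boxes gives the same result.
-/

noncomputable section

namespace KSchur

section Newton

variable {B : Type*} [CommRing B]

/-- The Newton basis polynomial `∏_{t < q} (x - β_t)` of degree `q` at the nodes `β`, as a function
of `x`. -/
def newton (β : ℕ → B) (q : ℕ) (x : B) : B := ∏ t ∈ Finset.range q, (x - β t)

theorem newton_zero (β : ℕ → B) (x : B) : newton β 0 x = 1 := rfl

theorem newton_succ (β : ℕ → B) (q : ℕ) (x : B) :
    newton β (q + 1) x = newton β q x * (x - β q) :=
  Finset.prod_range_succ _ _

theorem newton_add (β : ℕ → B) (s q : ℕ) (x : B) :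
    newton β (s + q) x = newton β s x * newton (fun t => β (s + t)) q x :=
  Finset.prod_range_add _ _ _

theorem newton_node_eq_zero (β : ℕ → B) {q k : ℕ} (h : k < q) : newton β q (β k) = 0 :=
  Finset.prod_eq_zero (Finset.mem_range.2 h) (sub_self _)

theorem map_newton {C : Type*} [CommRing C] (σ : B →+* C) {β : ℕ → B} {γ : ℕ → C} {q : ℕ}
    (h : ∀ t < q, σ (β t) = γ t) (x : B) : σ (newton β q x) = newton γ q (σ x) := by
  rw [newton, map_prod]
  exact Finset.prod_congr rfl fun t ht => by rw [map_sub, h t (Finset.mem_range.1 ht)]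

theorem prod_range_swap {M : Type*} [CommMonoid M] (f : ℕ → M) {c q : ℕ} (h : q ≠ c + 1) :
    ∏ t ∈ Finset.range q, f (Equiv.swap c (c + 1) t) = ∏ t ∈ Finset.range q, f t := by
  refine Finset.prod_equiv (Equiv.swap c (c + 1)) (fun t => ?_) (fun _ _ => rfl)
  simp only [Finset.mem_range, Equiv.swap_apply_def]
  split_ifs <;> omega

theorem prod_range_succ_swap {M : Type*} [CommMonoid M] (f : ℕ → M) (c : ℕ) :
    ∏ t ∈ Finset.range (c + 1), f (Equiv.swap c (c + 1) t) =
      (∏ t ∈ Finset.range c, f t) * f (c + 1) := by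
  rw [Finset.prod_range_succ, prod_range_swap f (by omega), Equiv.swap_apply_left]

theorem newton_swap_of_ne (β : ℕ → B) {c q : ℕ} (h : q ≠ c + 1) (x : B) :
    newton (fun t => β (Equiv.swap c (c + 1) t)) q x = newton β q x :=
  prod_range_swap (fun t => x - β t) h

theorem newton_swap_succ (β : ℕ → B) (c : ℕ) (x : B) :
    newton (fun t => β (Equiv.swap c (c + 1) t)) (c + 1) x = newton β c x * (x - β (c + 1)) :=
  prod_range_succ_swap (fun t => x - β t) c

/-- One step of Newton interpolation: exchanging the node `β p` for `β (r + 1)`. -/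
theorem sum_newton_Ico_step {β : ℕ → B} {G : ℕ → ℕ → B} {p r : ℕ} (hpr : p ≤ r)
    (hG : ∀ q, p ≤ q → q < r → (β p - β (q + 1)) * G p (q + 1) = G p q - G (p + 1) (q + 1))
    (x : B) :
    ∑ q ∈ Finset.Icc p r, G p q * ∏ t ∈ Finset.Ico p q, (x - β t) =
      ∑ q ∈ Finset.Icc (p + 1) r, G (p + 1) q * ∏ t ∈ Finset.Ico (p + 1) q, (x - β t) +
        G p r * ∏ t ∈ Finset.Ico (p + 1) (r + 1), (x - β t) := by
  induction r, hpr using Nat.le_induction with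
  | base => simp
  | succ r hpr ih =>
    rw [Finset.sum_Icc_succ_top (by omega), ih fun q h h' => hG q h (h'.trans r.lt_succ_self),
      Finset.sum_Icc_succ_top (by omega), Finset.prod_Ico_succ_top (by omega : p + 1 ≤ r + 1),
      Finset.prod_eq_prod_Ico_succ_bot (by omega : p < r + 1)]
    linear_combination
      -(∏ t ∈ Finset.Ico (p + 1) (r + 1), (x - β t)) * hG r hpr r.lt_succ_self

theorem newton_interpolation {β : ℕ → B} {G : ℕ → ℕ → B} {p k : ℕ} (hpk : p ≤ k)
    (hG : ∀ p q, p ≤ q → q < k → (β p - β (q + 1)) * G p (q + 1) = G p q - G (p + 1) (q + 1)) :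
    ∑ q ∈ Finset.Icc p k, G p q * ∏ t ∈ Finset.Ico p q, (β k - β t) = G k k := by
  induction hpk using Nat.decreasingInduction with
  | self => simp
  | of_succ p hp ih =>
    rw [sum_newton_Ico_step hp.le (hG p), ih,
      Finset.prod_eq_zero (Finset.mem_Ico.2 ⟨hp, k.lt_succ_self⟩) (sub_self _), mul_zero, add_zero]

/-- The Newton matrix diagonalizes every upper triangular array of divided differences. -/
theorem sum_mul_newton_node {β : ℕ → B} {G : ℕ → ℕ → B} {m p k : ℕ} (hk : k < m)
    (hzero : ∀ q < p, G p q = 0)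
    (hG : ∀ p q, p ≤ q → q < k → (β p - β (q + 1)) * G p (q + 1) = G p q - G (p + 1) (q + 1)) :
    ∑ q ∈ Finset.range m, G p q * newton β q (β k) = G k k * newton β p (β k) := by
  have hsupp : ∀ q ∈ Finset.range m, q ∉ Finset.Icc p k → G p q * newton β q (β k) = 0 := by
    intro q _ hq
    rcases lt_or_ge q p with h | h
    · rw [hzero q h, zero_mul]
    · rw [newton_node_eq_zero β (by_contra fun h' => hq (Finset.mem_Icc.2 ⟨h, not_lt.1 h'⟩)),
        mul_zero]
  have hsub : Finset.Icc p k ⊆ Finset.range m := fun q hq =>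
    Finset.mem_range.2 ((Finset.mem_Icc.1 hq).2.trans_lt hk)
  rw [← Finset.sum_subset hsub hsupp]
  rcases lt_or_ge k p with hkp | hpk
  · rw [Finset.Icc_eq_empty (by omega), Finset.sum_empty, newton_node_eq_zero β hkp, mul_zero]
  · rw [← newton_interpolation hpk hG, Finset.sum_mul]
    refine Finset.sum_congr rfl fun q hq => ?_
    rw [newton, newton, ← Finset.prod_range_mul_prod_Ico _ (Finset.mem_Icc.1 hq).1]
    ring

end Newton

section CompleteSymmetric

variable {ι κ : Type*} [Fintype ι] [DecidableEq ι] [Fintype κ] [DecidableEq κ]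
  {B C : Type*} [CommRing B] [CommRing C]

/-- The complete homogeneous symmetric polynomial of degree `d`, evaluated at a finite family. -/
def completeSymm (x : ι → B) (d : ℕ) : B :=
  MvPolynomial.aeval x (MvPolynomial.hsymm ι ℤ d)

theorem completeSymm_eq_sum (x : ι → B) (d : ℕ) :
    completeSymm x d = ∑ s : Sym ι d, (s.1.map x).prod := by
  simp only [completeSymm, MvPolynomial.hsymm, map_sum, map_multiset_prod, Multiset.map_map,
    Function.comp_apply, MvPolynomial.aeval_X]

theorem completeSymm_zero (x : ι → B) : completeSymm x 0 = 1 := by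
  rw [completeSymm, MvPolynomial.hsymm_zero, map_one]

theorem completeSymm_succ_of_isEmpty [IsEmpty ι] (x : ι → B) (d : ℕ) :
    completeSymm x (d + 1) = 0 := by
  rw [completeSymm_eq_sum, Finset.univ_eq_empty, Finset.sum_empty]

theorem completeSymm_comp_equiv (e : ι ≃ κ) (x : κ → B) (d : ℕ) :
    completeSymm (x ∘ e) d = completeSymm x d := by
  rw [completeSymm, ← MvPolynomial.aeval_rename, MvPolynomial.rename_hsymm, completeSymm]

theorem completeSymm_neg (x : ι → B) (d : ℕ) :
    completeSymm (fun i => -x i) d = (-1) ^ d * completeSymm x d := by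
  simp only [completeSymm_eq_sum, Finset.mul_sum]
  refine Finset.sum_congr rfl fun s _ => ?_
  have h : s.1.map (fun i => -x i) = (s.1.map x).map Neg.neg :=
    (Multiset.map_map Neg.neg x s.1).symm
  rw [h, Multiset.prod_map_neg, Multiset.card_map, s.2]

theorem map_completeSymm (φ : B →+* C) (x : ι → B) (d : ℕ) :
    φ (completeSymm x d) = completeSymm (fun i => φ (x i)) d := by
  simp only [completeSymm_eq_sum, map_sum, map_multiset_prod, Multiset.map_map,
    Function.comp_def]

theorem completeSymm_option (x : Option ι → B) (d : ℕ) :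
    completeSymm x (d + 1) =
      x none * completeSymm x d + completeSymm (fun i => x (some i)) (d + 1) := by
  simp only [completeSymm_eq_sum]
  rw [← (symOptionSuccEquiv (α := ι) (n := d)).symm.sum_comp, Fintype.sum_sum_type,
    Finset.mul_sum]
  congr 1
  · refine Finset.sum_congr rfl fun s _ => ?_
    change ((none ::ₘ s.1).map x).prod = _
    rw [Multiset.map_cons, Multiset.prod_cons]
  · refine Finset.sum_congr rfl fun s _ => ?_
    change ((s.1.map Function.Embedding.some).map x).prod = _
    rw [Multiset.map_map]
    rfl

theorem completeSymm_fin_succ (x : ℕ → B) (c d : ℕ) :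
    completeSymm (fun i : Fin (c + 1) => x i) (d + 1) =
      completeSymm (fun i : Fin c => x i) (d + 1) +
        x c * completeSymm (fun i : Fin (c + 1) => x i) d := by
  have hlast : ∀ d, completeSymm ((fun i : Fin (c + 1) => x i) ∘ finSuccEquivLast.symm) d =
      completeSymm (fun i : Fin (c + 1) => x i) d :=
    completeSymm_comp_equiv finSuccEquivLast.symm _
  rw [← hlast, completeSymm_option, hlast, add_comm]
  simp only [Function.comp_apply, finSuccEquivLast_symm_some, finSuccEquivLast_symm_none,
    Fin.val_last, Fin.val_castSucc]

theorem pow_eq_sum_completeSymm_mul_newton (x : ℕ → B) (y : B) (d : ℕ) :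
    y ^ d = ∑ p ∈ Finset.HasAntidiagonal.antidiagonal d,
      completeSymm (fun i : Fin (p.1 + 1) => x i) p.2 * newton x p.1 y := by
  induction d with
  | zero => simp [completeSymm_zero, newton_zero]
  | succ d ih =>
    have shift : ∑ p ∈ Finset.HasAntidiagonal.antidiagonal d,
          completeSymm (fun i : Fin p.1 => x i) (p.2 + 1) * newton x p.1 y + newton x (d + 1) y =
        ∑ p ∈ Finset.HasAntidiagonal.antidiagonal d,
          completeSymm (fun i : Fin (p.1 + 1) => x i) p.2 * newton x (p.1 + 1) y := by
      have h := Finset.Nat.sum_antidiagonal_succ' (n := d)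
        (f := fun p => completeSymm (fun i : Fin p.1 => x i) p.2 * newton x p.1 y)
      rw [Finset.Nat.sum_antidiagonal_succ] at h
      simp only [completeSymm_zero, completeSymm_succ_of_isEmpty, zero_mul, zero_add, one_mul] at h
      rw [h, add_comm]
    rw [Finset.Nat.sum_antidiagonal_succ']
    simp only [completeSymm_fin_succ, completeSymm_zero, one_mul, add_mul,
      Finset.sum_add_distrib]
    rw [← add_assoc, add_comm (newton x (d + 1) y), shift, ← Finset.sum_add_distrib, pow_succ, ih,
      Finset.sum_mul]
    refine Finset.sum_congr rfl fun p _ => ?_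
    rw [newton_succ]
    ring

theorem sub_pow_mul_newton (β : ℕ → B) (y x : B) (s h : ℕ) :
    (x - y) ^ h * newton β s x = ∑ c ∈ Finset.range (h + 1),
      completeSymm (fun i : Fin (c + 1) => β (s + i) - y) (h - c) * newton β (s + c) x := by
  rw [pow_eq_sum_completeSymm_mul_newton (fun t => β (s + t) - y),
    Finset.Nat.sum_antidiagonal_eq_sum_range_succ_mk, Finset.sum_mul]
  refine Finset.sum_congr rfl fun c _ => ?_
  have hshift : newton (fun t => β (s + t) - y) c (x - y) = newton (fun t => β (s + t)) c x :=
    Finset.prod_congr rfl fun t _ => sub_sub_sub_cancel_right _ _ _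
  rw [newton_add, hshift]
  ring

end CompleteSymmetric

section Alternants

variable {B : Type*} [CommRing B] {m L c i j : ℕ}

/-- The Newton basis polynomials of degree less than `m`, evaluated at the first `m` nodes. -/
def newtonMatrix (m : ℕ) (β : ℕ → B) : Matrix (Fin m) (Fin m) B :=
  Matrix.of fun q k => newton β q (β k)

theorem newtonMatrix_eq_zero (β : ℕ → B) {q k : Fin m} (h : k < q) : newtonMatrix m β q k = 0 :=
  newton_node_eq_zero β h

theorem det_newtonMatrix (m : ℕ) (β : ℕ → B) :
    (newtonMatrix m β).det = ∏ p : Fin m, newton β p (β p) :=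
  Matrix.det_of_isUpperTriangular fun _ _ h => newtonMatrix_eq_zero β h

theorem isUnit_det_newtonMatrix {β : ℕ → B}
    (hβ : ∀ s t, t < s → s < m → IsUnit (β s - β t)) : IsUnit (newtonMatrix m β).det := by
  rw [det_newtonMatrix, IsUnit.prod_univ_iff]
  exact fun p => IsUnit.prod_iff.2 fun t ht => hβ p t (Finset.mem_range.1 ht) p.2

/-- The square matrix with the rows `F_k ∏_{t < p} (β_k - γ_t)` for `p < L`, followed by the rows
`u 0, u 1, ...`. -/
def blockMatrix (m L : ℕ) (F β γ : ℕ → B) (u : ℕ → ℕ → B) : Matrix (Fin m) (Fin m) B :=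
  Matrix.of fun p k => if (p : ℕ) < L then F k * newton γ p (β k) else u (p - L) k

theorem newtonMatrix_eq_blockMatrix (m : ℕ) (β : ℕ → B) :
    newtonMatrix m β = blockMatrix m m 1 β β 0 := by
  ext q k
  simp only [newtonMatrix, blockMatrix, Matrix.of_apply, q.2, if_true, Pi.one_apply, one_mul]

theorem blockMatrix_update (F β γ : ℕ → B) (u : ℕ → ℕ → B) (hj : L + j < m) (v : ℕ → B) :
    blockMatrix m L F β γ (Function.update u j v) =
      (blockMatrix m L F β γ u).updateRow ⟨L + j, hj⟩ fun k => v k := by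
  ext p k
  simp only [blockMatrix, Matrix.of_apply, Matrix.updateRow_apply, Function.update_apply,
    Fin.ext_iff]
  split_ifs <;> first | rfl | omega

theorem det_blockMatrix_swap (hc : c + 1 < m) (F β γ : ℕ → B) (u : ℕ → ℕ → B) :
    (blockMatrix m L F β (fun t => γ (Equiv.swap c (c + 1) t)) u).det =
      (blockMatrix m L F β γ u).det := by
  rcases le_or_gt L (c + 1) with hL | hL
  · congr 1
    ext p k
    simp only [blockMatrix, Matrix.of_apply]
    split_ifs with hp
    · rw [newton_swap_of_ne γ (by omega)]
    · rfl
  have hrow : blockMatrix m L F β (fun t => γ (Equiv.swap c (c + 1) t)) u =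
      (blockMatrix m L F β γ u).updateRow ⟨c + 1, hc⟩
        (blockMatrix m L F β γ u ⟨c + 1, hc⟩ +
          (γ c - γ (c + 1)) • blockMatrix m L F β γ u ⟨c, by omega⟩) := by
    ext p k
    rw [Matrix.updateRow_apply]
    split_ifs with hp
    · subst hp
      simp only [blockMatrix, Matrix.of_apply, if_pos hL, if_pos (c.lt_succ_self.trans hL),
        Pi.add_apply, Pi.smul_apply, smul_eq_mul]
      rw [newton_swap_succ, newton_succ]
      ring
    · simp only [blockMatrix, Matrix.of_apply, newton_swap_of_ne γ fun h => hp (Fin.ext h)]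
  rw [hrow, Matrix.det_updateRow_add_smul_self _ (by simp [Fin.ext_iff])]

theorem map_det_blockMatrix (hc : c + 1 < m) {F β : ℕ → B} {u u' : ℕ → ℕ → B} {σ : B →+* B}
    (hF : ∀ t < m, σ (F t) = F (Equiv.swap c (c + 1) t))
    (hβ : ∀ t < m, σ (β t) = β (Equiv.swap c (c + 1) t))
    (hu : ∀ p k, L + p < m → k < m → σ (u p k) = u' p (Equiv.swap c (c + 1) k)) :
    σ (blockMatrix m L F β β u).det = -(blockMatrix m L F β β u').det := by
  set e : Equiv.Perm (Fin m) := Equiv.swap ⟨c, by omega⟩ ⟨c + 1, hc⟩ with he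
  have hval : ∀ k : Fin m, (e k : ℕ) = Equiv.swap c (c + 1) (k : ℕ) := by
    intro k
    simp only [he, Equiv.swap_apply_def, Fin.ext_iff]
    split_ifs <;> rfl
  have hmap : σ.mapMatrix (blockMatrix m L F β β u) =
      (blockMatrix m L F β (fun t => β (Equiv.swap c (c + 1) t)) u').submatrix id e := by
    ext p k
    simp only [RingHom.mapMatrix_apply, Matrix.map_apply, blockMatrix, Matrix.of_apply,
      Matrix.submatrix_apply, id, hval]
    split_ifs with hp
    · rw [map_mul, hF k k.2, map_newton σ fun t ht => hβ t (ht.trans p.2), hβ k k.2]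
    · exact hu _ k (by omega) k.2
  rw [RingHom.map_det, hmap, Matrix.det_permute', det_blockMatrix_swap hc, he,
    Equiv.Perm.sign_swap (by simp [Fin.ext_iff]), Units.val_neg, Units.val_one, Int.cast_neg,
    Int.cast_one, neg_one_mul]

theorem map_det_newtonMatrix (hc : c + 1 < m) {β : ℕ → B} {σ : B →+* B}
    (hβ : ∀ t < m, σ (β t) = β (Equiv.swap c (c + 1) t)) :
    σ (newtonMatrix m β).det = -(newtonMatrix m β).det := by
  rw [newtonMatrix_eq_blockMatrix]
  exact map_det_blockMatrix hc (fun _ _ => map_one σ) hβ fun p k h => absurd h (by omega)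

/-- The row `(β_k - 1)^h ∏_{t < L + p - h} (β_k - γ_t)` belonging to a column of height `h = h_p`
of the shape. -/
def columnRow (L : ℕ) (β γ : ℕ → B) (h : ℕ → ℕ) (p k : ℕ) : B :=
  (β k - 1) ^ h p * newton γ (L + p - h p) (β k)

/-- The numerator alternant of a shape with column heights `h`. -/
def shapeMatrix (m L : ℕ) (F β : ℕ → B) (h : ℕ → ℕ) : Matrix (Fin m) (Fin m) B :=
  blockMatrix m L F β β (columnRow L β β h)

theorem det_shapeMatrix_zero (hL : L ≤ m) (F β : ℕ → B) :
    (shapeMatrix m L F β 0).det = (∏ t ∈ Finset.range L, F t) * (newtonMatrix m β).det := by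
  have hrow : shapeMatrix m L F β 0 =
      Matrix.of fun p k : Fin m => (if (p : ℕ) < L then F k else 1) * newtonMatrix m β p k := by
    ext p k
    simp only [shapeMatrix, blockMatrix, columnRow, newtonMatrix, Matrix.of_apply, Pi.zero_apply,
      pow_zero, one_mul, Nat.sub_zero, ite_mul]
    split_ifs with hp
    · rfl
    · rw [Nat.add_sub_cancel' (not_lt.1 hp)]
  have hprod : ∏ p : Fin m, (if (p : ℕ) < L then F p else 1) = ∏ t ∈ Finset.range L, F t := by
    rw [Fin.prod_univ_eq_prod_range (fun t => if t < L then F t else 1) m, ← Finset.prod_filter]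
    congr 1
    ext t
    simp only [Finset.mem_filter, Finset.mem_range]
    omega
  rw [det_newtonMatrix, hrow, Matrix.det_of_isUpperTriangular]
  · simp only [Matrix.of_apply, Finset.prod_mul_distrib, hprod]
    rfl
  · intro p k hpk
    rw [Matrix.of_apply, newtonMatrix_eq_zero β (show k < p from hpk), mul_zero]

variable {β : ℕ → B} {h : ℕ → ℕ}

theorem columnRow_eq_update (hcij : c + 1 + i = L + j) (hi : h j = i) :
    columnRow L β β h = Function.update (columnRow L β β h) j
      fun k => (β k - 1) ^ i * newton β c (β k) * (β k - β c) := by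
  refine (Function.update_eq_self_iff.2 ?_).symm
  funext k
  rw [columnRow, hi, ← hcij, Nat.add_sub_cancel, newton_succ, mul_assoc]

theorem columnRow_swap (hcij : c + 1 + i = L + j) (hi : h j = i)
    (hend : ∀ p ≠ j, L + p - h p ≠ c + 1) :
    columnRow L β (fun t => β (Equiv.swap c (c + 1) t)) h =
      Function.update (columnRow L β β h) j
        fun k => (β k - 1) ^ i * newton β c (β k) * (β k - β (c + 1)) := by
  funext p
  rcases eq_or_ne p j with rfl | hp
  · funext k
    rw [Function.update_self, columnRow, hi, ← hcij, Nat.add_sub_cancel, newton_swap_succ,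
      mul_assoc]
  · funext k
    rw [Function.update_of_ne hp, columnRow, newton_swap_of_ne β (hend p hp), columnRow]

theorem columnRow_update (hcij : c + 1 + i = L + j) :
    columnRow L β β (Function.update h j (i + 1)) = Function.update (columnRow L β β h) j
      fun k => (β k - 1) ^ i * newton β c (β k) * (β k - 1) := by
  funext p
  rcases eq_or_ne p j with rfl | hp
  · funext k
    rw [Function.update_self, columnRow, Function.update_self,
      show L + p - (i + 1) = c by omega]
    ring
  · funext k
    rw [Function.update_of_ne hp, columnRow, Function.update_of_ne hp, columnRow]

/-- A Demazure operator adds the box `(i, j)`: after the reflection, the row of column `j` is the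
only one which sees the exchange of the nodes `c` and `c + 1`. -/
theorem det_shapeMatrix_add_box (hc : c + 1 < m) (hcij : c + 1 + i = L + j) (hj : L + j < m)
    (hi : h j = i) (hend : ∀ p ≠ j, L + p - h p ≠ c + 1) {F : ℕ → B} {σ : B →+* B}
    (hF : ∀ t < m, σ (F t) = F (Equiv.swap c (c + 1) t))
    (hβ : ∀ t < m, σ (β t) = β (Equiv.swap c (c + 1) t))
    {τ : B} (hτ : β c - τ * β (c + 1) = 1 - τ) :
    -(τ * σ (shapeMatrix m L F β h).det) - (shapeMatrix m L F β h).det =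
      (τ - 1) * (shapeMatrix m L F β (Function.update h j (i + 1))).det := by
  have hσ : σ (shapeMatrix m L F β h).det =
      -(blockMatrix m L F β β (columnRow L β (fun t => β (Equiv.swap c (c + 1) t)) h)).det := by
    refine map_det_blockMatrix hc hF hβ fun p k hp hk => ?_
    rw [columnRow, map_mul, map_pow, map_sub, map_one, hβ k hk,
      map_newton σ fun t ht => hβ t (by omega), hβ k hk, columnRow]
  rw [hσ, columnRow_swap hcij hi hend, shapeMatrix, shapeMatrix, columnRow_update hcij]
  nth_rw 2 [columnRow_eq_update hcij hi]
  simp only [blockMatrix_update _ _ _ _ hj]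
  set D := blockMatrix m L F β β (columnRow L β β h)
  set P : Fin m → B := fun k => (β k - 1) ^ i * newton β c (β k)
  have hlin : τ * (D.updateRow ⟨L + j, hj⟩ fun k => P k * (β k - β (c + 1))).det =
      (D.updateRow ⟨L + j, hj⟩ fun k => P k * (β k - β c)).det +
        (τ - 1) * (D.updateRow ⟨L + j, hj⟩ fun k => P k * (β k - 1)).det := by
    rw [← Matrix.det_updateRow_smul, ← Matrix.det_updateRow_smul, ← Matrix.det_updateRow_add]
    congr 2
    funext k
    simp only [Pi.smul_apply, Pi.add_apply, smul_eq_mul]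
    linear_combination P k * hτ
  linear_combination hlin

end Alternants

section YoungDiagrams

theorem lt_rowLen_iff_lt_colLen (lam : YoungDiagram) (i j : ℕ) :
    j < lam.rowLen i ↔ i < lam.colLen j := by
  rw [← YoungDiagram.mem_iff_lt_rowLen, YoungDiagram.mem_iff_lt_colLen]

theorem rowLen_bot : (⊥ : YoungDiagram).rowLen = 0 :=
  funext fun i => Nat.eq_zero_of_not_pos fun h =>
    YoungDiagram.notMem_bot (i, 0) (YoungDiagram.mem_iff_lt_rowLen.2 h)

theorem colLen_bot : (⊥ : YoungDiagram).colLen = 0 :=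
  funext fun j => Nat.eq_zero_of_not_pos fun h =>
    YoungDiagram.notMem_bot (0, j) (YoungDiagram.mem_iff_lt_colLen.2 h)

/-- The diagram `ν` arises from `μ` by adding the box in row `i` and column `j`. -/
structure IsAddBox (μ : YoungDiagram) (i j : ℕ) (ν : YoungDiagram) : Prop where
  notMem : (i, j) ∉ μ
  mem_iff : ∀ c, c ∈ ν ↔ c = (i, j) ∨ c ∈ μ

namespace IsAddBox

variable {μ ν : YoungDiagram} {i j : ℕ}

theorem transpose (h : IsAddBox μ i j ν) : IsAddBox μ.transpose j i ν.transpose where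
  notMem hμ := h.notMem (YoungDiagram.mem_transpose.1 hμ)
  mem_iff c := by
    rw [YoungDiagram.mem_transpose, h.mem_iff, YoungDiagram.mem_transpose]
    exact or_congr_left (Prod.swap_eq_iff_eq_swap (x := c) (y := (i, j)))

theorem rowLen_eq (h : IsAddBox μ i j ν) : μ.rowLen i = j := by
  refine le_antisymm (not_lt.1 fun hj => h.notMem (YoungDiagram.mem_iff_lt_rowLen.2 hj))
    (not_lt.1 fun hj => ?_)
  have hν : (i, μ.rowLen i) ∈ ν := ν.up_left_mem le_rfl hj.le ((h.mem_iff _).2 (Or.inl rfl))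
  rcases (h.mem_iff _).1 hν with heq | hμ
  · exact hj.ne (Prod.ext_iff.1 heq).2
  · exact lt_irrefl _ (YoungDiagram.mem_iff_lt_rowLen.1 hμ)

theorem colLen_eq (h : IsAddBox μ i j ν) : μ.colLen j = i := by
  rw [← h.transpose.rowLen_eq, YoungDiagram.rowLen_transpose]

theorem rowLen_eq_update (h : IsAddBox μ i j ν) :
    ν.rowLen = Function.update μ.rowLen i (j + 1) := by
  refine funext fun k => eq_of_forall_lt_iff fun x => ?_
  rw [← YoungDiagram.mem_iff_lt_rowLen, h.mem_iff, YoungDiagram.mem_iff_lt_rowLen, Prod.mk.injEq,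
    Function.update_apply]
  have := h.rowLen_eq
  split_ifs with hk
  · subst hk
    omega
  · simp only [hk, false_and, false_or]

theorem colLen_eq_update (h : IsAddBox μ i j ν) :
    ν.colLen = Function.update μ.colLen j (i + 1) := by
  have := h.transpose.rowLen_eq_update
  simpa only [funext_iff, YoungDiagram.rowLen_transpose, Function.update_apply] using this

theorem rowLen_add_ne (h : IsAddBox μ i j ν) {k : ℕ} (hk : k ≠ i) :
    μ.rowLen k + i ≠ j + k ∧ μ.rowLen k + i ≠ j + 1 + k := by
  have hi : ν.rowLen i = j + 1 := by rw [h.rowLen_eq_update, Function.update_self]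
  have hk' : ν.rowLen k = μ.rowLen k := by rw [h.rowLen_eq_update, Function.update_of_ne hk]
  rcases hk.lt_or_gt with hlt | hgt
  · have := ν.rowLen_anti k i hlt.le
    omega
  · have := μ.rowLen_anti i k hgt.le
    have := h.rowLen_eq
    omega

theorem colLen_add_ne (h : IsAddBox μ i j ν) {p : ℕ} (hp : p ≠ j) : μ.colLen p + j ≠ i + p := by
  have := (h.transpose.rowLen_add_ne hp).1
  rwa [YoungDiagram.rowLen_transpose] at this

theorem rowLen_le (h : IsAddBox μ i j ν) (k : ℕ) : μ.rowLen k ≤ ν.rowLen k := by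
  have := h.rowLen_eq
  rw [h.rowLen_eq_update, Function.update_apply]
  split_ifs with hk
  · subst hk
    omega
  · exact le_rfl

theorem colLen_le (h : IsAddBox μ i j ν) (k : ℕ) : μ.colLen k ≤ ν.colLen k := by
  have := h.transpose.rowLen_le k
  rwa [YoungDiagram.rowLen_transpose, YoungDiagram.rowLen_transpose] at this

theorem lt_rowLen_zero (h : IsAddBox μ i j ν) : j < ν.rowLen 0 :=
  (YoungDiagram.mem_iff_lt_rowLen.1 ((h.mem_iff _).2 (Or.inl rfl))).trans_le
    (ν.rowLen_anti 0 i i.zero_le)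

theorem lt_colLen_zero (h : IsAddBox μ i j ν) : i < ν.colLen 0 :=
  (YoungDiagram.mem_iff_lt_colLen.1 ((h.mem_iff _).2 (Or.inl rfl))).trans_le
    (ν.colLen_anti 0 j j.zero_le)

end IsAddBox

/-- The leg length of the box `(i, i)` if it belongs to `λ`, and otherwise the number of boxes
missing in row `i` to the left of the diagonal. -/
def diagLeg (lam : YoungDiagram) (i : ℕ) : ℕ :=
  if (i, i) ∈ lam then lam.colLen i - i - 1 else i - lam.rowLen i

theorem neg_diagLeg (lam : YoungDiagram) (i : ℕ) :
    -(diagLeg lam i : ℤ) =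
      if (i, i) ∈ lam then (i : ℤ) + 1 - lam.colLen i else (lam.rowLen i : ℤ) - i := by
  have := lt_rowLen_iff_lt_colLen lam i i
  simp only [diagLeg, YoungDiagram.mem_iff_lt_colLen]
  split_ifs <;> omega

theorem diagLeg_lt {lam : YoungDiagram} {i : ℕ} (hi : i < lam.colLen 0) :
    diagLeg lam i < lam.colLen 0 := by
  have := lam.colLen_anti 0 i i.zero_le
  rw [diagLeg]
  split_ifs <;> omega

theorem diagLeg_injective (lam : YoungDiagram) : Function.Injective (diagLeg lam) := by
  refine .of_lt_imp_ne fun i k hik => ?_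
  have := lt_rowLen_iff_lt_colLen lam i i
  have := lt_rowLen_iff_lt_colLen lam k k
  have := lt_rowLen_iff_lt_colLen lam i k
  have := lt_rowLen_iff_lt_colLen lam k i
  have := lam.colLen_anti i k hik.le
  have := lam.rowLen_anti i k hik.le
  simp only [diagLeg, YoungDiagram.mem_iff_lt_colLen]
  split_ifs <;> omega

theorem sum_diagLeg {M : Type*} [AddCommMonoid M] (lam : YoungDiagram) (φ : ℕ → M) :
    ∑ i ∈ Finset.range (lam.colLen 0), φ (diagLeg lam i) =
      ∑ i ∈ Finset.range (lam.colLen 0), φ i := by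
  have himage : (Finset.range (lam.colLen 0)).image (diagLeg lam) =
      Finset.range (lam.colLen 0) := by
    refine Finset.eq_of_subset_of_card_le (Finset.image_subset_iff.2 fun i hi => ?_)
      (Finset.card_image_of_injective _ (diagLeg_injective lam)).ge
    exact Finset.mem_range.2 (diagLeg_lt (Finset.mem_range.1 hi))
  conv_rhs => rw [← himage]
  exact (Finset.sum_image (diagLeg_injective lam).injOn).symm

end YoungDiagrams

section Nodes

variable {n L c t : ℕ}

/-- The residue attached to the column `t` of `N_λ`, where `L = λ'_1`. -/
def colResidue (n L t : ℕ) : ZMod n := (t : ZMod n) + 1 - (L : ZMod n)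

theorem colResidue_succ (n L t : ℕ) : colResidue n L (t + 1) = colResidue n L t + 1 := by
  rw [colResidue, colResidue, Nat.cast_succ]
  ring

theorem colResidue_injOn (n L : ℕ) : Set.InjOn (colResidue n L) (Set.Iio n) := by
  intro s hs t ht h
  have hst : (s : ZMod n) = t := by simpa only [colResidue, sub_left_inj, add_left_inj] using h
  rwa [ZMod.natCast_eq_natCast_iff', Nat.mod_eq_of_lt hs, Nat.mod_eq_of_lt ht] at hst

theorem colResidue_eq_zero_iff (hc : c + 1 < n) (hL : L ≤ n) :
    colResidue n L c = 0 ↔ c + 1 = L := by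
  rw [colResidue, sub_eq_zero, ← Nat.cast_succ, ZMod.natCast_eq_natCast_iff',
    Nat.mod_eq_of_lt hc]
  rcases hL.eq_or_lt with rfl | hL
  · rw [Nat.mod_self]
    omega
  · rw [Nat.mod_eq_of_lt hL]

theorem colResidue_ne_add_one (hc : c + 1 < n) : colResidue n L c ≠ colResidue n L c + 1 := by
  rw [← colResidue_succ]
  exact fun h => c.lt_succ_self.ne (colResidue_injOn n L (c.lt_succ_self.trans hc) hc h)

theorem swap_colResidue (hc : c + 1 < n) (ht : t < n) :
    Equiv.swap (colResidue n L c) (colResidue n L c + 1) (colResidue n L t) =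
      colResidue n L (Equiv.swap c (c + 1) t) := by
  rw [← colResidue_succ]
  rcases eq_or_ne t c with rfl | h₁
  · rw [Equiv.swap_apply_left, Equiv.swap_apply_left]
  rcases eq_or_ne t (c + 1) with rfl | h₂
  · rw [Equiv.swap_apply_right, Equiv.swap_apply_right]
  rw [Equiv.swap_apply_of_ne_of_ne h₁ h₂, Equiv.swap_apply_of_ne_of_ne]
  · exact fun h => h₁ (colResidue_injOn n L ht (c.lt_succ_self.trans hc) h)
  · exact fun h => h₂ (colResidue_injOn n L ht hc h)

theorem sub_eq_colResidue {i r : ℕ} (hi : i < L) :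
    (r : ZMod n) - (i : ZMod n) = colResidue n L (r + (L - 1 - i)) := by
  rw [colResidue, Nat.cast_add, Nat.sub_sub, Nat.cast_sub (by omega : 1 + i ≤ L), Nat.cast_add,
    Nat.cast_one]
  ring

/-- The level zero action on power series of the simple reflection `s_i`, by exchanging `a_i` and
`a_{i + 1}` in the coefficients. -/
def swapCoeff {n : ℕ} (i : ZMod n) : Series n →+* Series n :=
  MvPowerSeries.map (permRTΔ (Equiv.swap i (i + 1)))

theorem swapCoeff_cst (i : ZMod n) (x : RTΔ n) :
    swapCoeff i (cst x) = cst (permRTΔ (Equiv.swap i (i + 1)) x) :=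
  MvPowerSeries.map_C _ _

theorem permRTΔ_b (s : Equiv.Perm (ZMod n)) (i : ZMod n) : permRTΔ s (b i) = b (s i) := by
  rw [b, map_sub, map_one, permRTΔ_ex, map_neg, permWeight_a, b]

theorem swapCoeff_Ω (i k : ZMod n) :
    swapCoeff i (Ω k : Series n) = (Ω (Equiv.swap i (i + 1) k) : Series n) := by
  ext d
  rw [swapCoeff, MvPowerSeries.coeff_map]
  change permRTΔ _ (b k ^ d.degree) = b _ ^ d.degree
  rw [map_pow, permRTΔ_b]

/-- The node attached to the column `t` of `N_λ`, where `L = λ'_1`. -/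
def node (n L t : ℕ) : Series n := cst (b (colResidue n L t))

/-- The value `e^{-a_i} Ω(b_i|y)` at the node `b_i` of the diagonal of `Z A`. -/
def nodeValue (n L t : ℕ) : Series n :=
  cst (ex (-a (colResidue n L t))) * (Ω (colResidue n L t) : Series n)

theorem swapCoeff_node (hc : c + 1 < n) (ht : t < n) :
    swapCoeff (colResidue n L c) (node n L t) = node n L (Equiv.swap c (c + 1) t) := by
  rw [node, swapCoeff_cst, permRTΔ_b, swap_colResidue hc ht, node]

theorem swapCoeff_nodeValue (hc : c + 1 < n) (ht : t < n) :
    swapCoeff (colResidue n L c) (nodeValue n L t) = nodeValue n L (Equiv.swap c (c + 1) t) := by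
  rw [nodeValue, map_mul, swapCoeff_cst, permRTΔ_ex, map_neg, permWeight_a, swapCoeff_Ω,
    swap_colResidue hc ht, nodeValue]

theorem isUnit_node_sub_node {s : ℕ} (hs : s < n) (ht : t < n) (hst : s ≠ t) :
    IsUnit (node n L s - node n L t) := by
  rw [node, node, cst, cst, ← map_sub]
  exact (isUnit_b_sub_b fun h => hst (colResidue_injOn n L hs ht h)).map _

theorem isUnit_det_newtonMatrix_node {m : ℕ} (hm : m ≤ n) :
    IsUnit (newtonMatrix m (node n L)).det :=
  isUnit_det_newtonMatrix fun _ _ hts hs =>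
    isUnit_node_sub_node (hs.trans_le hm) ((hts.trans hs).trans_le hm) hts.ne'

theorem ex_mul_ex_neg (μ : Weight n) : ex μ * ex (-μ) = 1 := by
  rw [← ex_add, add_neg_cancel, ex_zero]

theorem node_sub_mul_node_succ (n L c : ℕ) :
    node n L c - cst (ex (-α (colResidue n L c))) * node n L (c + 1) =
      1 - cst (ex (-α (colResidue n L c))) := by
  have hweight : -α (colResidue n L c) + -a (colResidue n L (c + 1)) = -a (colResidue n L c) := by
    rw [α, colResidue_succ]
    abel
  rw [node, node, ← map_mul, ← map_sub, b, b, mul_sub, mul_one, ← ex_add, hweight,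
    ← map_one (MvPowerSeries.C (σ := ℕ)), ← map_sub]
  congr 1
  ring

end Nodes

section Demazure

variable {n : ℕ} {i : ZMod n}

theorem ex_neg_sub_one (μ : Weight n) : ex (-μ) - 1 = ex (-μ) * (1 - ex μ) := by
  rw [mul_sub, mul_one, mul_comm, ex_mul_ex_neg]

theorem isUnit_one_sub_ex_α (hi : i ≠ i + 1) : IsUnit (1 - ex (α i)) :=
  isUnit_one_sub_ex hi

theorem isUnit_cst_ex_neg_α_sub_one (hi : i ≠ i + 1) : IsUnit (cst (ex (-α i)) - 1) := by
  rw [← map_one (MvPowerSeries.C (σ := ℕ)), cst, ← map_sub, ex_neg_sub_one]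
  exact ((IsUnit.of_mul_eq_one_right (ex (α i)) (ex_mul_ex_neg _)).mul
    (isUnit_one_sub_ex_α hi)).map _

theorem cst_ex_neg_α_sub_one_mul_T (hi : i ≠ i + 1) (Y : Series n) :
    (cst (ex (-α i)) - 1) * T i Y = cst (ex (-α i)) * (simpleReflection i Y - Y) := by
  have hcancel : (ex (-α i) - 1) * Ring.inverse (1 - ex (α i)) = ex (-α i) := by
    rw [ex_neg_sub_one, mul_assoc, Ring.mul_inverse_cancel _ (isUnit_one_sub_ex_α hi), mul_one]
  rw [← map_one (MvPowerSeries.C (σ := ℕ)), cst, ← map_sub, T, ← mul_assoc, ← map_mul, hcancel]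

/-- The product of the series `Ω(b_i|y)` over the residues `i` of a first column of height `L`. -/
def columnProd (n L : ℕ) : (Series n)ˣ := ∏ i ∈ Finset.range L, Ω (-(i : ZMod n))

theorem coe_columnProd (n L : ℕ) :
    (columnProd n L : Series n) = ∏ t ∈ Finset.range L, (Ω (colResidue n L t) : Series n) := by
  rw [columnProd, Units.coe_prod, ← Finset.prod_range_reflect]
  refine Finset.prod_congr rfl fun t ht => ?_
  have ht := Finset.mem_range.1 ht
  rw [← zero_sub, ← Nat.cast_zero, sub_eq_colResidue (by omega : L - 1 - t < L)]
  congr 3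
  omega

theorem columnProd_mul_simpleReflection {L c : ℕ} (hL : L ≤ n) (hc : c + 1 < n) (Y : Series n) :
    columnProd n L * simpleReflection (colResidue n L c) Y =
      swapCoeff (colResidue n L c) (columnProd n L * Y) := by
  have hswap : swapCoeff (colResidue n L c) (columnProd n L) =
      ∏ t ∈ Finset.range L, (Ω (colResidue n L (Equiv.swap c (c + 1) t)) : Series n) := by
    rw [coe_columnProd, map_prod]
    refine Finset.prod_congr rfl fun t ht => ?_
    rw [swapCoeff_Ω, swap_colResidue hc ((Finset.mem_range.1 ht).trans_le hL)]
  rw [map_mul, hswap, simpleReflection, ← swapCoeff, ← mul_assoc, coe_columnProd]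
  congr 1
  have hzero := colResidue_eq_zero_iff hc hL
  split_ifs with h
  · rw [← hzero.1 h, prod_range_succ_swap (fun t => (Ω (colResidue n (c + 1) t) : Series n)),
      Finset.prod_range_succ, colResidue_succ, hzero.1 h, h, zero_add, mul_assoc, ← Units.val_mul,
      mul_div_cancel]
  · rw [mul_one, prod_range_swap (fun t => (Ω (colResidue n L t) : Series n))
      fun hLc => h (hzero.2 hLc.symm)]

end Demazure

section RowWeight

variable {n L i j : ℕ} {μ ν : YoungDiagram}

/-- The sum of the weights `a_{λ_i - i + 1}` over the first `L` rows, the index being the residue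
following the end of the row. -/
def rowWeight (n L : ℕ) (lam : YoungDiagram) : Weight n :=
  ∑ i ∈ Finset.range L, a ((lam.rowLen i : ZMod n) - (i : ZMod n))

theorem IsAddBox.rowWeight_eq (h : IsAddBox μ i j ν) (hi : i < L) :
    rowWeight n L ν = rowWeight n L μ + -α ((j : ZMod n) - (i : ZMod n)) := by
  have hi := Finset.mem_range.2 hi
  have hrest : ∑ k ∈ (Finset.range L).erase i, a ((ν.rowLen k : ZMod n) - (k : ZMod n)) =
      ∑ k ∈ (Finset.range L).erase i, a ((μ.rowLen k : ZMod n) - (k : ZMod n)) :=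
    Finset.sum_congr rfl fun k hk => by
      rw [h.rowLen_eq_update, Function.update_of_ne (Finset.ne_of_mem_erase hk)]
  rw [rowWeight, rowWeight, ← Finset.add_sum_erase _ _ hi, hrest,
    ← Finset.add_sum_erase (Finset.range L) _ hi, h.rowLen_eq, h.rowLen_eq_update,
    Function.update_self, α, Nat.cast_succ, add_sub_right_comm]
  abel

theorem IsAddBox.permWeight_rowWeight (h : IsAddBox μ i j ν) (hL : ν.colLen 0 ≤ L)
    (hn : L + ν.rowLen 0 ≤ n) :
    permWeight (Equiv.swap ((j : ZMod n) - (i : ZMod n)) ((j : ZMod n) - (i : ZMod n) + 1))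
      (rowWeight n L μ) = rowWeight n L ν := by
  have hi : i < L := h.lt_colLen_zero.trans_le hL
  have hj := h.lt_rowLen_zero
  rw [rowWeight, rowWeight, map_sum]
  refine Finset.sum_congr rfl fun k hk => ?_
  have hkL := Finset.mem_range.1 hk
  have hμ := (h.rowLen_le k).trans (ν.rowLen_anti 0 k k.zero_le)
  rw [permWeight_a, sub_eq_colResidue hi, sub_eq_colResidue hkL, sub_eq_colResidue hkL,
    swap_colResidue (by omega) (by omega), Equiv.swap_apply_def, h.rowLen_eq_update,
    Function.update_apply]
  congr 2
  rcases eq_or_ne k i with rfl | hki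
  · rw [h.rowLen_eq, if_pos rfl, if_pos rfl]
    omega
  · have := h.rowLen_add_ne hki
    rw [if_neg (by omega), if_neg (by omega), if_neg hki]

theorem diagWeight_add_columnWeight (n : ℕ) (lam : YoungDiagram) :
    diagWeight n lam + columnWeight n lam = rowWeight n (lam.colLen 0) lam := by
  rw [columnWeight, ← sum_diagLeg lam fun i => (a (-(i : ZMod n)) : Weight n), diagWeight,
    Finset.sum_filter, ← Finset.sum_add_distrib, rowWeight]
  refine Finset.sum_congr rfl fun i _ => ?_
  have hleg : -(diagLeg lam i : ZMod n) =
      ((if (i, i) ∈ lam then (i : ℤ) + 1 - lam.colLen i else (lam.rowLen i : ℤ) - i : ℤ) :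
        ZMod n) := by
    rw [← neg_diagLeg, Int.cast_neg, Int.cast_natCast]
  rw [hleg]
  split_ifs
  · rw [sub_add_cancel]
    push_cast
    congr 1
    ring
  · rw [zero_add, Int.cast_sub, Int.cast_natCast, Int.cast_natCast]

end RowWeight

section Bialternants

variable {n m L i j : ℕ} {μ ν lam : YoungDiagram} {Y : Series n}

/-- Up to the monomial `rowWeight` and the unit `columnProd`, the series `Y` is the quotient of the
alternant of shape `μ` by the Newton (Vandermonde) alternant; stated without division. -/
def IsBialternant (n m L : ℕ) (μ : YoungDiagram) (Y : Series n) : Prop :=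
  (newtonMatrix m (node n L)).det * (columnProd n L * Y) =
    cst (ex (rowWeight n L μ)) * (shapeMatrix m L (nodeValue n L) (node n L) μ.colLen).det

theorem IsBialternant.T (H : IsBialternant n m L μ Y) (h : IsAddBox μ i j ν)
    (hL : ν.colLen 0 ≤ L) (hm : L + ν.rowLen 0 ≤ m) (hmn : m ≤ n) :
    IsBialternant n m L ν (T ((j : ZMod n) - (i : ZMod n)) Y) := by
  have hi : i < L := h.lt_colLen_zero.trans_le hL
  have hj := h.lt_rowLen_zero
  obtain ⟨c, hc⟩ : ∃ c, c = j + (L - 1 - i) := ⟨_, rfl⟩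
  have hres : (j : ZMod n) - (i : ZMod n) = colResidue n L c := by rw [sub_eq_colResidue hi, hc]
  have hcm : c + 1 < m := by omega
  have hcn : c + 1 < n := hcm.trans_le hmn
  have hnode : ∀ t < m, swapCoeff (colResidue n L c) (node n L t) =
      node n L (Equiv.swap c (c + 1) t) := fun t ht => swapCoeff_node hcn (ht.trans_le hmn)
  have hend : ∀ p ≠ j, L + p - μ.colLen p ≠ c + 1 := by
    intro p hp
    have := h.colLen_add_ne hp
    have := (h.colLen_le p).trans (ν.colLen_anti 0 p p.zero_le)
    omega
  have hadd := det_shapeMatrix_add_box (F := nodeValue n L) hcm (by omega) (by omega)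
    h.colLen_eq hend (fun t ht => swapCoeff_nodeValue hcn (ht.trans_le hmn)) hnode
    (node_sub_mul_node_succ n L c)
  have hweight : (cst (ex (rowWeight n L ν)) : Series n) =
      cst (ex (rowWeight n L μ)) * cst (ex (-α (colResidue n L c))) := by
    rw [h.rowWeight_eq hi, ex_add, hres, cst, map_mul]
  have hσ := congrArg (swapCoeff (colResidue n L c)) H
  rw [map_mul, map_det_newtonMatrix hcm hnode,
    ← columnProd_mul_simpleReflection (by omega) hcn, map_mul, swapCoeff_cst, permRTΔ_ex, ← hres,
    h.permWeight_rowWeight hL (hm.trans hmn), hres, hweight] at hσ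
  have hT := cst_ex_neg_α_sub_one_mul_T (colResidue_ne_add_one (L := L) hcn) Y
  refine (isUnit_cst_ex_neg_α_sub_one (colResidue_ne_add_one (L := L) hcn)).mul_left_cancel ?_
  unfold IsBialternant at H
  rw [hres, hweight, h.colLen_eq_update]
  set τ : Series n := cst (ex (-α (colResidue n L c)))
  linear_combination (newtonMatrix m (node n L)).det * columnProd n L * hT - τ * hσ - τ * H +
    cst (ex (rowWeight n L μ)) * τ * hadd

theorem prod_nodeValue (n L : ℕ) :
    ∏ t ∈ Finset.range L, nodeValue n L t = cst (ex (-rowWeight n L ⊥)) * columnProd n L := by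
  have hweight : rowWeight n L ⊥ = ∑ t ∈ Finset.range L, a (colResidue n L t) := by
    rw [rowWeight, ← Finset.sum_range_reflect]
    refine Finset.sum_congr rfl fun t ht => ?_
    have ht := Finset.mem_range.1 ht
    rw [rowLen_bot, Pi.zero_apply, sub_eq_colResidue (by omega : L - 1 - t < L)]
    congr 2
    omega
  have hex : ∀ s : Finset ℕ, ex (-∑ t ∈ s, a (colResidue n L t)) =
      ∏ t ∈ s, ex (-a (colResidue n L t)) := by
    intro s
    induction s using Finset.cons_induction with
    | empty => rw [Finset.sum_empty, neg_zero, ex_zero, Finset.prod_empty]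
    | cons t s ht ih => rw [Finset.sum_cons, neg_add, ex_add, ih, Finset.prod_cons]
  simp only [nodeValue, cst]
  rw [Finset.prod_mul_distrib, coe_columnProd, hweight, hex, ← map_prod]

theorem isBialternant_bot (n : ℕ) (hL : L ≤ m) : IsBialternant n m L ⊥ 1 := by
  have hcancel : (cst (ex (rowWeight n L ⊥)) : Series n) * cst (ex (-rowWeight n L ⊥)) = 1 := by
    rw [cst, cst, ← map_mul, ex_mul_ex_neg, map_one]
  rw [IsBialternant, colLen_bot, det_shapeMatrix_zero hL, prod_nodeValue]
  linear_combination -(columnProd n L : Series n) * (newtonMatrix m (node n L)).det * hcancel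

theorem isBialternant_Tword (cs : List (ℕ × ℕ)) (hcs : cs.Pairwise fun c d => ¬c ≤ d)
    (hμ : ∀ c, c ∈ μ ↔ c ∈ cs) (hL : μ.colLen 0 ≤ L) (hm : L + μ.rowLen 0 ≤ m) (hmn : m ≤ n) :
    IsBialternant n m L μ (Tword (cs.map fun c => (c.2 : ZMod n) - (c.1 : ZMod n)) 1) := by
  induction cs generalizing μ with
  | nil =>
    obtain rfl : μ = ⊥ := YoungDiagram.ext (Finset.ext fun c => by
      simpa only [YoungDiagram.mem_cells, YoungDiagram.notMem_bot, List.not_mem_nil] using hμ c)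
    exact isBialternant_bot n (le_of_add_le_left hm)
  | cons c cs ih =>
    obtain ⟨hc, hcs⟩ := List.pairwise_cons.1 hcs
    let μ' : YoungDiagram :=
      { cells := cs.toFinset
        isLowerSet := fun x y hyx hx => by
          have hx : x ∈ cs := List.mem_toFinset.1 hx
          have hy : y ∈ μ := μ.isLowerSet hyx ((hμ x).2 (List.mem_cons_of_mem c hx))
          refine List.mem_toFinset.2 ((List.mem_cons.1 ((hμ y).1 hy)).resolve_left ?_)
          rintro rfl
          exact hc x hx hyx }
    have hμ' : ∀ d, d ∈ μ' ↔ d ∈ cs := fun d => List.mem_toFinset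
    have hbox : IsAddBox μ' c.1 c.2 μ :=
      ⟨fun h => hc c ((hμ' c).1 h) le_rfl, fun d => by rw [hμ, List.mem_cons, hμ']⟩
    exact (ih hcs hμ' ((hbox.colLen_le 0).trans hL)
      ((Nat.add_le_add_left (hbox.rowLen_le 0) L).trans hm)).T hbox hL hm hmn

/-- The boxes in the reading order of `readingWord`. -/
def readingCells (lam : YoungDiagram) : List (ℕ × ℕ) :=
  ((List.range (lam.colLen 0)).flatMap fun i =>
    (List.range (lam.rowLen i)).map fun j => (i, j)).reverse

theorem readingWord_eq_map (n : ℕ) (lam : YoungDiagram) :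
    readingWord n lam = (readingCells lam).map fun c => (c.2 : ZMod n) - (c.1 : ZMod n) := by
  simp only [readingWord, readingCells, List.map_reverse, List.map_flatMap, List.map_map,
    Function.comp_def, List.bind_eq_flatMap, List.pure_def, ← List.map_eq_flatMap]

theorem mem_readingCells (c : ℕ × ℕ) : c ∈ lam ↔ c ∈ readingCells lam := by
  have h : c ∈ lam → c.1 < lam.colLen 0 := fun hc =>
    (YoungDiagram.mem_iff_lt_colLen.1 hc).trans_le (lam.colLen_anti 0 c.2 c.2.zero_le)
  simp only [readingCells, List.mem_reverse, List.mem_flatMap, List.mem_map, List.mem_range]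
  constructor
  · exact fun hc => ⟨c.1, h hc, c.2, YoungDiagram.mem_iff_lt_rowLen.1 hc, rfl⟩
  · rintro ⟨i, -, j, hj, rfl⟩
    exact YoungDiagram.mem_iff_lt_rowLen.2 hj

theorem pairwise_readingCells (lam : YoungDiagram) :
    (readingCells lam).Pairwise fun c d => ¬c ≤ d := by
  rw [readingCells, List.pairwise_reverse, List.pairwise_flatMap]
  refine ⟨fun i _ => List.pairwise_map.2 (List.pairwise_lt_range.imp fun hj h => ?_),
    List.pairwise_lt_range.imp fun hi c hc d hd h => ?_⟩
  · exact hj.not_ge h.2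
  · obtain ⟨_, -, rfl⟩ := List.mem_map.1 hc
    obtain ⟨_, -, rfl⟩ := List.mem_map.1 hd
    exact hi.not_ge h.1

theorem isBialternant_g (hlam : IsKSmall n lam) :
    IsBialternant n (lam.colLen 0 + lam.rowLen 0) (lam.colLen 0) lam (g n lam) := by
  rw [g, readingWord_eq_map]
  exact isBialternant_Tword _ (pairwise_readingCells lam) mem_readingCells le_rfl le_rfl
    ((Nat.add_comm _ _).trans_le hlam.2)

end Bialternants

section Matrices

variable {n : ℕ} {lam : YoungDiagram} {p k m : ℕ}

theorem ZA_eq (n : ℕ) (i j : ℤ) :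
    ZA n i j = z n i j * cst (ex (-a (j : ZMod n))) - z n i (j - 1) := by
  have hz : ∀ t ∉ Finset.Icc i j, t ≤ j → z n i t = 0 := fun t ht htj =>
    if_neg fun hit => ht (Finset.mem_Icc.2 ⟨hit, htj⟩)
  have hterm : ∀ t, z n i t * cst (A n t j) =
      (if t = j then z n i t * cst (ex (-a (j : ZMod n))) else 0) -
        (if t = j - 1 then z n i t else 0) := by
    intro t
    have hsucc : t + 1 = j ↔ t = j - 1 := by omega
    simp only [A, hsucc]
    split_ifs with hj hpred hpred
    · omega
    · rw [hj, sub_zero]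
    · rw [cst, map_neg, map_one, mul_neg_one, zero_sub]
    · rw [cst, map_zero, mul_zero, sub_zero]
  simp only [ZA, hterm]
  rw [Finset.sum_sub_distrib, Finset.sum_ite_eq', Finset.sum_ite_eq']
  congr 1 <;> refine ite_eq_left_iff.2 fun h => ?_
  · rw [hz j h le_rfl, zero_mul]
  · rw [hz (j - 1) h (by omega)]

theorem ZA_eq_zero {i j : ℤ} (h : j < i) : ZA n i j = 0 := by
  rw [ZA, Finset.Icc_eq_empty h.not_ge, Finset.sum_empty]

theorem ZA_self (n : ℕ) (i : ℤ) :
    ZA n i i = cst (ex (-a (i : ZMod n))) * (Ω (i : ZMod n) : Series n) := by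
  rw [ZA_eq, z, z, if_pos le_rfl, if_neg (by omega), sub_self, Int.toNat_zero, zAux, sub_zero,
    mul_comm]

theorem ZA_relation {i j : ℤ} (hij : i ≤ j) (h : (i : ZMod n) ≠ ((j + 1 : ℤ) : ZMod n))
    (h' : i < j → (i : ZMod n) ≠ (j : ZMod n)) :
    cst (b (i : ZMod n) - b ((j + 1 : ℤ) : ZMod n)) * ZA n i (j + 1) =
      ZA n i j - ZA n (i + 1) (j + 1) := by
  have hz := z_relation n (Int.lt_add_one_of_le hij) h
  have hz' : cst (b (i : ZMod n) - b (j : ZMod n)) * z n i j =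
      z n i (j - 1) - z n (i + 1) j := by
    rcases hij.eq_or_lt with rfl | hlt
    · rw [sub_self, cst, map_zero, zero_mul, z, z, if_neg (by omega), if_neg (by omega), sub_self]
    · exact z_relation n hlt (h' hlt)
  rw [add_sub_cancel_right] at hz
  simp only [ZA_eq, b, cst, map_sub, map_one, add_sub_cancel_right] at hz hz' ⊢
  linear_combination cst (ex (-a ((j + 1 : ℤ) : ZMod n))) * hz - hz'

theorem intCast_l_add (n : ℕ) (lam : YoungDiagram) (t : ℕ) :
    ((l n lam + t : ℤ) : ZMod n) = colResidue n (lam.colLen 0) t := by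
  rw [l, colResidue]
  push_cast
  rw [ZMod.natCast_self]
  ring

theorem sum_ZA_mul_newton_node (hm : m ≤ n) (hk : k < m) :
    ∑ q ∈ Finset.range m, ZA n (l n lam + p) (l n lam + q) *
      newton (node n (lam.colLen 0)) q (node n (lam.colLen 0) k) =
    nodeValue n (lam.colLen 0) k *
      newton (node n (lam.colLen 0)) p (node n (lam.colLen 0) k) := by
  have hne : ∀ {s t : ℕ}, s < t → t < m →
      ((l n lam + s : ℤ) : ZMod n) ≠ ((l n lam + t : ℤ) : ZMod n) := by
    intro s t hst ht h
    rw [intCast_l_add, intCast_l_add] at h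
    exact hst.ne (colResidue_injOn n _ ((hst.trans ht).trans_le hm) (ht.trans_le hm) h)
  have hdiag : ZA n (l n lam + k) (l n lam + k) = nodeValue n (lam.colLen 0) k := by
    rw [ZA_self, intCast_l_add, nodeValue]
  rw [← hdiag]
  refine sum_mul_newton_node (G := fun s t => ZA n (l n lam + (s : ℕ)) (l n lam + (t : ℕ))) hk
    (fun q hq => ZA_eq_zero (by omega)) fun s t hst ht => ?_
  have hrel := ZA_relation (n := n) (i := l n lam + s) (j := l n lam + t) (by omega)
    (by simpa only [Nat.cast_succ, add_assoc] using hne (Nat.lt_succ_of_le hst) (by omega))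
    fun h => hne (by omega) (by omega)
  simp only [add_assoc, ← Nat.cast_succ] at hrel
  rwa [intCast_l_add, intCast_l_add, cst, map_sub] at hrel

theorem f_eq_zero {c : ℕ} (h : lam.colLen p < c) : f n lam c p = 0 := by
  obtain ⟨c, rfl⟩ := Nat.exists_eq_succ_of_ne_zero (Nat.ne_zero_of_lt h)
  have : IsEmpty (Finset.Icc (c + 1) (lam.colLen p)) := by
    rw [Finset.Icc_eq_empty h.not_ge]
    infer_instance
  exact completeSymm_succ_of_isEmpty _ c

/-- The decreasing enumeration of an interval. -/
def finEquivIcc {h c : ℕ} (hc : c ≤ h) : Fin (c + 1) ≃ Finset.Icc (h - c) h where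
  toFun i := ⟨h - i, Finset.mem_Icc.2 (by omega)⟩
  invFun s := ⟨h - s, by have := Finset.mem_Icc.1 s.2; omega⟩
  left_inv i := Fin.ext (by dsimp only; omega)
  right_inv s := Subtype.ext (by have := Finset.mem_Icc.1 s.2; dsimp only; omega)

theorem f_eq_completeSymm {c : ℕ} (hc : c ≤ lam.colLen p) :
    f n lam (lam.colLen p - c) p = completeSymm (fun i : Fin (c + 1) =>
      ex (-a (colResidue n (lam.colLen 0) (lam.colLen 0 + p - lam.colLen p + i))))
      (lam.colLen p - c) := by
  have := lam.colLen_anti 0 p p.zero_le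
  refine (completeSymm_comp_equiv (finEquivIcc hc) _ _).symm.trans ?_
  congr 1
  funext i
  have hi := i.2
  change ex (-a (((p : ℤ) + 1 - ((lam.colLen p - i : ℕ) : ℤ) : ℤ) : ZMod n)) = _
  have hcol : l n lam + (lam.colLen 0 + p - lam.colLen p + i : ℕ) =
      n + ((p : ℤ) + 1 - (lam.colLen p - i : ℕ)) := by
    rw [l]
    omega
  rw [← intCast_l_add, hcol, Int.cast_add, Int.cast_natCast n, ZMod.natCast_self, zero_add]

theorem W_eq {q : ℕ} (hq : q ≤ lam.colLen 0 + p) :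
    W n lam p (l n lam + q) =
      (-1) ^ (lam.colLen 0 + p - q) * f n lam (lam.colLen 0 + p - q) p := by
  have hexp : ((n : ℤ) + p + 1 - (l n lam + q)).toNat = lam.colLen 0 + p - q := by
    rw [l]
    omega
  rw [W, if_pos (by rw [l]; omega), hexp]

theorem W_eq_zero {q : ℕ}
    (hq : q ∉ Finset.Ico (lam.colLen 0 + p - lam.colLen p) (lam.colLen 0 + p + 1)) :
    W n lam p (l n lam + q) = 0 := by
  rw [Finset.mem_Ico] at hq
  rcases le_or_gt q (lam.colLen 0 + p) with h | h
  · rw [W_eq h, f_eq_zero (by omega), mul_zero]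
  · rw [W, if_neg (by rw [l]; omega)]

theorem cst_W {c : ℕ} (hc : c ≤ lam.colLen p) :
    (cst (W n lam p (l n lam + (lam.colLen 0 + p - lam.colLen p + c : ℕ))) : Series n) =
      completeSymm (fun i : Fin (c + 1) =>
        node n (lam.colLen 0) (lam.colLen 0 + p - lam.colLen p + i) - 1) (lam.colLen p - c) := by
  have := lam.colLen_anti 0 p p.zero_le
  have hnode : ∀ t, node n (lam.colLen 0) t - 1 =
      cst (-ex (-a (colResidue n (lam.colLen 0) t))) := by
    intro t
    rw [node, b, cst, cst, map_sub, map_one, map_neg]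
    ring
  have hdeg : lam.colLen 0 + p - (lam.colLen 0 + p - lam.colLen p + c) = lam.colLen p - c := by
    omega
  simp only [hnode]
  rw [W_eq (by omega), hdeg, f_eq_completeSymm hc, ← completeSymm_neg, cst, map_completeSymm]

theorem sum_W_mul_newton_node (hp : lam.colLen 0 + p < m) :
    ∑ q ∈ Finset.range m, cst (W n lam p (l n lam + q)) *
      newton (node n (lam.colLen 0)) q (node n (lam.colLen 0) k) =
    columnRow (lam.colLen 0) (node n (lam.colLen 0)) (node n (lam.colLen 0)) lam.colLen p k := by
  have := lam.colLen_anti 0 p p.zero_le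
  have hsub : Finset.Ico (lam.colLen 0 + p - lam.colLen p) (lam.colLen 0 + p + 1) ⊆
      Finset.range m := fun q hq =>
    Finset.mem_range.2 ((Finset.mem_Ico.1 hq).2.trans_le hp)
  have hlen : lam.colLen 0 + p + 1 - (lam.colLen 0 + p - lam.colLen p) = lam.colLen p + 1 := by
    omega
  rw [columnRow, sub_pow_mul_newton, ← Finset.sum_subset hsub fun q _ hq => by
    rw [W_eq_zero hq, cst, map_zero, zero_mul], Finset.sum_Ico_eq_sum_range, hlen]
  exact Finset.sum_congr rfl fun c hc => by rw [cst_W (Finset.mem_range_succ_iff.1 hc)]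

theorem N_mul_newtonMatrix (hlam : IsKSmall n lam) :
    N n lam * newtonMatrix (lam.colLen 0 + lam.rowLen 0) (node n (lam.colLen 0)) =
      shapeMatrix (lam.colLen 0 + lam.rowLen 0) (lam.colLen 0) (nodeValue n (lam.colLen 0))
        (node n (lam.colLen 0)) lam.colLen := by
  have hn : lam.colLen 0 + lam.rowLen 0 ≤ n := (Nat.add_comm _ _).trans_le hlam.2
  ext1 p k
  simp only [Matrix.mul_apply, N, newtonMatrix, Matrix.of_apply, shapeMatrix, blockMatrix]
  split_ifs with hp
  · rw [← sum_ZA_mul_newton_node hn k.2]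
    exact Fin.sum_univ_eq_sum_range (fun q => ZA n (l n lam + (p : ℕ)) (l n lam + (q : ℕ)) *
      newton (node n (lam.colLen 0)) q (node n (lam.colLen 0) k)) _
  · rw [← sum_W_mul_newton_node (m := lam.colLen 0 + lam.rowLen 0) (by omega)]
    exact Fin.sum_univ_eq_sum_range
      (fun q => cst (W n lam (p - lam.colLen 0) (l n lam + (q : ℕ))) *
        newton (node n (lam.colLen 0)) q (node n (lam.colLen 0) k)) _

end Matrices

end KSchur

end

theorem mainTheorem5 (n : ℕ) (hn : 2 ≤ n) (lam : YoungDiagram) (hlam : KSchur.IsKSmall n lam) :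
    KSchur.g n lam =
      KSchur.cst (KSchur.ex (KSchur.diagWeight n lam + KSchur.columnWeight n lam)) *
        ((KSchur.N n lam).det /ₚ KSchur.ξ n lam) := by
  have hunit : IsUnit (KSchur.newtonMatrix (lam.colLen 0 + lam.rowLen 0)
      (KSchur.node n (lam.colLen 0))).det :=
    KSchur.isUnit_det_newtonMatrix_node ((Nat.add_comm _ _).trans_le hlam.2)
  have hcolumn : KSchur.columnProd n (lam.colLen 0) = KSchur.ξ n lam := rfl
  have hg := KSchur.isBialternant_g hlam
  rw [KSchur.IsBialternant, ← KSchur.N_mul_newtonMatrix hlam, Matrix.det_mul, hcolumn] at hg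
  rw [KSchur.diagWeight_add_columnWeight, ← divp_assoc, eq_divp_iff_mul_eq]
  refine hunit.mul_left_cancel ?_
  linear_combination hg
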